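/- Let $X$ be a complete metric space with metric $d$ and let $p \ge 1$ be a real number. Let $P_p(X)$ be the set of Radon probability measures on $X$ (Borel probability measures $\mu$ with $\mu(B) = \sup\{\mu(C) \mid C \subseteq B,\ C \text{ compact}\}$ for every Borel set $B$) with finite moment of order $p$, i.e. $\int d(x_0,x)^p\,\mathrm{d}\mu(x) < \infty$ for some (equivalently, every) $x_0 \in X$. For $\mu,\nu \in P_p(X)$ let $$W_p(\mu,\nu) = \Big(\inf_\gamma \int d(x,y)^p\,\mathrm{d}\gamma(x,y)\Big)^{1/p},$$ where $\gamma$ runs over the couplings of $\mu$ and $\nu$, i.e. the Borel probability measures on $X \times X$ with first marginal $\mu$ and second marginal $\nu$. Then $W_p$ is a (finite-valued) metric on $P_p(X)$ and it metrises $p$-weak convergence: for every $x_0 \in X$, every sequence $(\mu_i)_{i \ge 0}$ in $P_p(X)$ and every $\mu \in P_p(X)$, one has $\mu_i \to \mu$ with respect to $W_p$ if and only if $\mu_i$ converges $p$-weakly to $\mu$, that is, $\int f\,\mathrm{d}\mu_i \to \int f\,\mathrm{d}\mu$ for every bounded continuous $f : X \to \mathbb{R}$ and $\int d(x_0,x)^p\,\mathrm{d}\mu_i(x)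 \to \int d(x_0,x)^p\,\mathrm{d}\mu(x)$. -/

import Mathlib

open MeasureTheory Filter Topology
open scoped ENNReal

namespace Wasserstein

variable {X : Type*} [MetricSpace X] [MeasurableSpace X] [BorelSpace X]

/-- The moment of order `p` about `x₀`: the integral of `d(x₀, -) ^ p`. The integrand is Borel, so
this is the usual integral, with values in `[0, ∞]`. -/
noncomputable def moment (p : ℝ) (x₀ : X) (μ : Measure X) : ℝ≥0∞ :=
  ∫⁻ x, edist x₀ x ^ p ∂μ

/-- A coupling of `μ` and `ν`: a Borel probability measure on the topological space `X × X` with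
marginals `μ` and `ν`. As `X` need not be separable, the Borel σ-algebra of `X × X` may be strictly
finer than the product σ-algebra, so it is named explicitly. -/
structure IsCoupling (γ : @Measure (X × X) (borel (X × X))) (μ ν : Measure X) : Prop where
  isProbabilityMeasure : @IsProbabilityMeasure (X × X) (borel (X × X)) γ
  map_fst : @Measure.map (X × X) X (borel (X × X)) _ Prod.fst γ = μ
  map_snd : @Measure.map (X × X) X (borel (X × X)) _ Prod.snd γ = ν

/-- The integral of `d ^ p` with respect to a Borel measure on `X × X`. -/
noncomputable def cost (p : ℝ) (γ : @Measure (X × X) (borel (X × X))) : ℝ≥0∞ :=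
  @lintegral (X × X) (borel (X × X)) γ (fun z => edist z.1 z.2 ^ p)

/-- The Wasserstein distance of order `p`: the `p`-th root of the infimum of the integrals of
`d ^ p` over all couplings. -/
noncomputable def wassersteinDist (p : ℝ) (μ ν : Measure X) : ℝ≥0∞ :=
  (⨅ (γ : @Measure (X × X) (borel (X × X))) (_ : IsCoupling γ μ ν), cost p γ) ^ (1 / p)

/-- `P_p(X)`: the Radon probability measures on `X` with finite moment of order `p`. Mathlib's
`Measure.InnerRegular` says that the measure of each Borel set is the supremum of the measures of
its compact subsets. -/
@[ext]
structure PSpace (p : ℝ) (X : Type*) [MetricSpace X] [MeasurableSpace X] [BorelSpace X] where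
  toProb : ProbabilityMeasure X
  radon : (toProb : Measure X).InnerRegular
  finite_moment : ∃ x₀ : X, moment p x₀ (toProb : Measure X) < ∞

/-- `p`-weak convergence of a sequence in `P_p(X)`, with base point `x₀`: weak convergence (the
topology of `ProbabilityMeasure X` is that of convergence of integrals of bounded continuous
functions) together with convergence of the moments of order `p` about `x₀`. -/
def PWeakTendsto {p : ℝ} (x₀ : X) (μs : ℕ → PSpace p X) (μ : PSpace p X) : Prop :=
  Tendsto (fun i => (μs i).toProb) atTop (𝓝 μ.toProb) ∧
    Tendsto (fun i => moment p x₀ ((μs i).toProb : Measure X)) atTop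
      (𝓝 (moment p x₀ (μ.toProb : Measure X)))

end Wasserstein

/-!
A coupling may live on a Borel σ-algebra finer than the product one. Radon measures are nevertheless
concentrated on σ-compact sets, which are standard Borel because they are measurable in their
completions; so random variables with Radon laws are almost everywhere strongly measurable, joint
laws on the product σ-algebra transfer to couplings, and disintegration glues couplings, which gives
the triangle inequality without completeness of `X`.

By Markov's inequality a coupling of small cost bounds the Lévy–Prokhorov distance, whence weak
convergence; the moments converge by Minkowski's inequality. Conversely, take a finite partition of
unity subordinate to small balls and summing to one on a compact set of almost full measure. Weak
convergence lets almost all mass be matched inside its pieces, at small cost. The remaining mass is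
coupled independently, and its cost is controlled by the tails of the moments, which are uniformly
small because the moments converge.
-/

namespace Wasserstein

open scoped NNReal

section SigmaCompact

open ProbabilityTheory

theorem measurableSet_of_isSigmaCompact {X : Type*} [TopologicalSpace X] [T2Space X]
    [MeasurableSpace X] [OpensMeasurableSpace X] {S : Set X} (hS : IsSigmaCompact S) :
    MeasurableSet S := by
  obtain ⟨K, hK, rfl⟩ := hS
  exact .iUnion fun n => (hK n).measurableSet

theorem standardBorelSpace_of_measurableEmbedding {Y Z : Type*} [MeasurableSpace Y]
    [MeasurableSpace Z] [StandardBorelSpace Z] {e : Y → Z} (he : MeasurableEmbedding e) :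
    StandardBorelSpace Y := by
  obtain ⟨τ, hτ, _⟩ := he.measurableSet_range.standardBorel.polish
  let φ := he.equivRange
  let : TopologicalSpace Y := τ.induced φ
  refine ⟨⟨inferInstance, ⟨?_⟩, φ.toEquiv.polishSpace_induced⟩⟩
  rw [← φ.measurableEmbedding.comap_eq, borel_comap, ← hτ.measurable_eq]

-- A σ-compact space has measurable image in its completion.
theorem standardBorelSpace_of_sigmaCompactSpace {Y : Type*} [MetricSpace Y] [SigmaCompactSpace Y]
    [MeasurableSpace Y] [BorelSpace Y] : StandardBorelSpace Y := by
  let : MeasurableSpace (UniformSpace.Completion Y) := borel _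
  have : BorelSpace (UniformSpace.Completion Y) := ⟨rfl⟩
  have hrange := isSigmaCompact_range (UniformSpace.Completion.continuous_coe Y)
  exact standardBorelSpace_of_measurableEmbedding
    ((UniformSpace.Completion.isUniformEmbedding_coe Y).isEmbedding.measurableEmbedding
      (measurableSet_of_isSigmaCompact hrange))

theorem exists_isSigmaCompact_ae_mem {X : Type*} [TopologicalSpace X] [T2Space X]
    [MeasurableSpace X] [OpensMeasurableSpace X] (μ : Measure X) [IsFiniteMeasure μ]
    [μ.InnerRegular] : ∃ S, IsSigmaCompact S ∧ ∀ᵐ x ∂μ, x ∈ S := by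
  have hK : ∀ n : ℕ, ∃ K, IsCompact K ∧ μ Kᶜ < (n + 1 : ℝ≥0∞)⁻¹ := fun n => by
    obtain ⟨K, -, hK, hlt⟩ := MeasurableSet.univ.exists_isCompact_sdiff_lt (measure_ne_top μ _)
      (ε := (n + 1 : ℝ≥0∞)⁻¹) (by simp)
    exact ⟨K, hK, by rwa [Set.compl_eq_univ_sdiff]⟩
  choose K hK hlt using hK
  refine ⟨⋃ n, K n, isSigmaCompact_iUnion_of_isCompact K hK, ?_⟩
  refine ae_iff.2 (le_antisymm (ge_of_tendsto'
    (ENNReal.tendsto_inv_nat_nhds_zero.comp (tendsto_add_atTop_nat 1)) fun n => ?_) zero_le)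
  refine (measure_mono fun x hx => ?_).trans (by simpa using (hlt n).le)
  exact fun hxn => hx (Set.mem_iUnion_of_mem n hxn)

variable {X : Type*} [MetricSpace X] [MeasurableSpace X] [BorelSpace X]

theorem aestronglyMeasurable_of_innerRegular_map {Ω : Type*} {mΩ : MeasurableSpace Ω}
    {P : Measure Ω} [IsFiniteMeasure P] {f : Ω → X} (hf : AEMeasurable f P)
    (h : (P.map f).InnerRegular) : AEStronglyMeasurable f P := by
  obtain ⟨S, hS, hfS⟩ := exists_isSigmaCompact_ae_mem (P.map f)
  have := isSigmaCompact_iff_sigmaCompactSpace.1 hS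
  exact aestronglyMeasurable_iff_aemeasurable_separable.2
    ⟨hf, S, .of_subtype S, ae_of_ae_map hf hfS⟩

theorem exists_kernel_compProd_eq {B : Type*} [MeasurableSpace B] (π : Measure (B × X))
    [IsProbabilityMeasure π] (h : π.snd.InnerRegular) :
    ∃ κ : Kernel B X, IsMarkovKernel κ ∧ π.fst ⊗ₘ κ = π := by
  obtain ⟨S, hS, hπS⟩ := exists_isSigmaCompact_ae_mem π.snd
  have hSm := measurableSet_of_isSigmaCompact hS
  have := isSigmaCompact_iff_sigmaCompactSpace.1 hS
  have : StandardBorelSpace S := standardBorelSpace_of_sigmaCompactSpace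
  have : Nonempty S := nonempty_subtype.2 hπS.exists
  have he : MeasurableEmbedding (Prod.map id (↑) : B × S → B × X) :=
    .prodMap .id (.subtype_coe hSm)
  have hmap : (π.comap (Prod.map id (↑) : B × S → B × X)).map (Prod.map id (↑)) = π := by
    rw [he.map_comap, Set.range_prodMap]
    refine Measure.restrict_eq_self_of_ae_mem ?_
    filter_upwards [ae_of_ae_map measurable_snd.aemeasurable hπS] with z hz
    simpa using hz
  set π' := π.comap (Prod.map id (↑) : B × S → B × X)
  have hfst : π.fst = π'.fst := by
    rw [← hmap, Measure.fst, Measure.map_map measurable_fst he.measurable]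
    rfl
  refine ⟨π'.condKernel.map (↑), Kernel.IsMarkovKernel.map _ measurable_subtype_coe, ?_⟩
  rw [hfst, Measure.compProd_map measurable_subtype_coe, π'.disintegrate, hmap]

theorem exists_gluing {B : Type*} [MeasurableSpace B] {Y : Type*} [MetricSpace Y]
    [MeasurableSpace Y] [BorelSpace Y] (π : Measure (B × X)) (ρ : Measure (B × Y))
    [IsProbabilityMeasure π] [IsProbabilityMeasure ρ] (h : π.fst = ρ.fst)
    (hπ : π.snd.InnerRegular) (hρ : ρ.snd.InnerRegular) :
    ∃ R : Measure (B × X × Y), IsProbabilityMeasure R ∧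
      R.map (Prod.map id Prod.fst) = π ∧ R.map (Prod.map id Prod.snd) = ρ := by
  obtain ⟨κ, _, hκ⟩ := exists_kernel_compProd_eq π hπ
  obtain ⟨η, _, hη⟩ := exists_kernel_compProd_eq ρ hρ
  refine ⟨π.fst ⊗ₘ (κ ×ₖ η), inferInstance, ?_, ?_⟩
  · rw [← Measure.compProd_map measurable_fst, ← Kernel.fst_eq, Kernel.fst_prod, hκ]
  · rw [← Measure.compProd_map measurable_snd, ← Kernel.snd_eq, Kernel.snd_prod, h, hη]

end SigmaCompact

section Coupling

universe u

variable {X : Type*} [MetricSpace X] [MeasurableSpace X] {p : ℝ} {μ ν : Measure X}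

-- Throughout this section `X × X` carries its Borel σ-algebra, on which couplings are defined.
local instance : MeasurableSpace (X × X) := borel (X × X)

local instance : BorelSpace (X × X) := ⟨rfl⟩

theorem exists_isCoupling_cost_lt (hp : 0 < p) {c : ℝ≥0∞} (h : wassersteinDist p μ ν < c) :
    ∃ γ, IsCoupling γ μ ν ∧ cost p γ ^ (1 / p) < c := by
  rw [wassersteinDist, one_div, ENNReal.rpow_inv_lt_iff hp] at h
  simpa only [one_div, ENNReal.rpow_inv_lt_iff hp, iInf_lt_iff, exists_prop] using h

variable [BorelSpace X]

theorem isCoupling_map {Ω : Type*} [MeasurableSpace Ω] {P : Measure Ω}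
    [IsProbabilityMeasure P] {f g : Ω → X} (hfg : AEMeasurable (fun ω => (f ω, g ω)) P) :
    IsCoupling (P.map fun ω => (f ω, g ω)) (P.map f) (P.map g) where
  isProbabilityMeasure := Measure.isProbabilityMeasure_map hfg
  map_fst := AEMeasurable.map_map_of_aemeasurable continuous_fst.aemeasurable hfg
  map_snd := AEMeasurable.map_map_of_aemeasurable continuous_snd.aemeasurable hfg

theorem wassersteinDist_map_le_of_aemeasurable_prodMk (hp : 0 ≤ p) {Ω : Type*}
    [MeasurableSpace Ω] {P : Measure Ω} [IsProbabilityMeasure P] {f g : Ω → X}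
    (hfg : AEMeasurable (fun ω => (f ω, g ω)) P) :
    wassersteinDist p (P.map f) (P.map g) ≤ (∫⁻ ω, edist (f ω) (g ω) ^ p ∂P) ^ (1 / p) :=
  have hγ : IsCoupling (P.map fun ω => (f ω, g ω)) (P.map f) (P.map g) := isCoupling_map hfg
  ENNReal.rpow_le_rpow (iInf₂_le_of_le _ hγ (lintegral_map_le _ _)) (by positivity)

theorem wassersteinDist_map_le (hp : 0 ≤ p) {Ω : Type*} [MeasurableSpace Ω] {P : Measure Ω}
    [IsProbabilityMeasure P] {f g : Ω → X} (hf : AEStronglyMeasurable f P)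
    (hg : AEStronglyMeasurable g P) :
    wassersteinDist p (P.map f) (P.map g) ≤ (∫⁻ ω, edist (f ω) (g ω) ^ p ∂P) ^ (1 / p) :=
  wassersteinDist_map_le_of_aemeasurable_prodMk hp (hf.prodMk hg).aemeasurable

theorem exists_randomVariables_of_wassersteinDist_lt {X : Type u} [MetricSpace X]
    [MeasurableSpace X] [BorelSpace X] {μ ν : Measure X} (hp : 0 < p) {c : ℝ≥0∞}
    (h : wassersteinDist p μ ν < c) :
    ∃ (Ω : Type u) (_ : MeasurableSpace Ω) (P : Measure Ω) (f g : Ω → X),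
      IsProbabilityMeasure P ∧ Measurable f ∧ Measurable g ∧ P.map f = μ ∧ P.map g = ν ∧
      (∫⁻ ω, edist (f ω) (g ω) ^ p ∂P) ^ (1 / p) < c := by
  obtain ⟨γ, ⟨hprob, hfst, hsnd⟩, hγ⟩ := exists_isCoupling_cost_lt hp h
  exact ⟨X × X, _, γ, Prod.fst, Prod.snd, hprob, continuous_fst.measurable,
    continuous_snd.measurable, hfst, hsnd, hγ⟩

theorem wassersteinDist_self (hp : 0 < p) (μ : Measure X) [IsProbabilityMeasure μ] :
    wassersteinDist p μ μ = 0 := by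
  have h := wassersteinDist_map_le_of_aemeasurable_prodMk (P := μ) (f := id) (g := id) hp.le
    (continuous_id.prodMk continuous_id).aemeasurable
  simpa [hp] using h

theorem wassersteinDist_comm_le (hp : 0 < p) (μ ν : Measure X) :
    wassersteinDist p ν μ ≤ wassersteinDist p μ ν := by
  refine le_of_forall_gt fun c hc => ?_
  obtain ⟨γ, ⟨_, rfl, rfl⟩, hγ⟩ := exists_isCoupling_cost_lt hp hc
  refine (wassersteinDist_map_le_of_aemeasurable_prodMk hp.le
    continuous_swap.aemeasurable).trans_lt ?_
  simpa only [cost, edist_comm] using hγ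

theorem wassersteinDist_comm (hp : 0 < p) (μ ν : Measure X) :
    wassersteinDist p μ ν = wassersteinDist p ν μ :=
  le_antisymm (wassersteinDist_comm_le hp ν μ) (wassersteinDist_comm_le hp μ ν)

theorem measurable_edist_rpow (p : ℝ) (x₀ : X) : Measurable fun x => edist x₀ x ^ p :=
  measurable_edist_right.pow_const p

theorem moment_rpow_le (hp : 1 ≤ p) (x₀ : X) (μ ν : Measure X) :
    moment p x₀ μ ^ (1 / p) ≤ moment p x₀ ν ^ (1 / p) + wassersteinDist p μ ν := by
  have hp₀ : 0 < p := by positivity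
  refine tsub_le_iff_left.1 (le_of_forall_gt fun c hc => ?_)
  obtain ⟨γ, ⟨_, rfl, rfl⟩, hγ⟩ := exists_isCoupling_cost_lt hp₀ hc
  refine lt_of_le_of_lt (tsub_le_iff_left.2 ?_) hγ
  rw [moment, moment, lintegral_map (measurable_edist_rpow p x₀) continuous_fst.measurable,
    lintegral_map (measurable_edist_rpow p x₀) continuous_snd.measurable]
  calc (∫⁻ z, edist x₀ z.1 ^ p ∂γ) ^ (1 / p)
      ≤ (∫⁻ z, (edist x₀ z.2 + edist z.1 z.2) ^ p ∂γ) ^ (1 / p) := by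
        gcongr with z
        rw [edist_comm z.1]
        exact edist_triangle _ _ _
    _ ≤ (∫⁻ z, edist x₀ z.2 ^ p ∂γ) ^ (1 / p) + cost p γ ^ (1 / p) :=
        ENNReal.lintegral_Lp_add_le
          (measurable_edist_right.comp continuous_snd.measurable).aemeasurable
          continuous_edist.aemeasurable hp

theorem measure_le_thickening_add (hp : 0 < p) {γ : Measure (X × X)} (hγ : IsCoupling γ μ ν)
    {δ : ℝ≥0∞} (hδ₀ : δ ≠ 0) (hδ : δ ≠ ∞) (hcost : cost p γ ≤ δ ^ p * δ) {B : Set X}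
    (hB : MeasurableSet B) : μ B ≤ ν (Metric.thickening δ.toReal B) + δ := by
  have hMarkov : γ {z | δ ^ p ≤ edist z.1 z.2 ^ p} ≤ δ := by
    have hpow : δ ^ p ≠ 0 ∧ δ ^ p ≠ ∞ := by simp [hδ₀, hδ]
    refine (ENNReal.mul_le_mul_iff_right hpow.1 hpow.2).1 ?_
    exact (mul_meas_ge_le_lintegral (continuous_edist.measurable.pow_const p) _).trans hcost
  have hsub : Prod.fst ⁻¹' B ⊆ Prod.snd ⁻¹' Metric.thickening δ.toReal B ∪
      {z : X × X | δ ^ p ≤ edist z.1 z.2 ^ p} := fun z hz => by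
    rcases lt_or_ge (edist z.1 z.2) δ with h | h
    · refine Or.inl (Metric.mem_thickening_iff_infEDist_lt.2 ?_)
      rw [ENNReal.ofReal_toReal hδ]
      exact (Metric.infEDist_le_edist_of_mem (x := z.2) hz).trans_lt (by rwa [edist_comm])
    · exact Or.inr (ENNReal.rpow_le_rpow h hp.le)
  obtain ⟨_, rfl, rfl⟩ := hγ
  rw [Measure.map_apply continuous_fst.measurable hB,
    Measure.map_apply continuous_snd.measurable Metric.isOpen_thickening.measurableSet]
  exact (measure_mono hsub).trans ((measure_union_le _ _).trans (add_le_add_right hMarkov _))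

end Coupling

section Triangle

variable {X : Type*} [MetricSpace X] [MeasurableSpace X] [BorelSpace X] {p : ℝ}

theorem exists_measure_prod_of_wassersteinDist_lt (hp : 0 < p) {μ ν : Measure X} {c : ℝ≥0∞}
    (h : wassersteinDist p μ ν < c) :
    ∃ π : Measure (X × X), IsProbabilityMeasure π ∧ π.fst = μ ∧ π.snd = ν ∧
      (∫⁻ z, edist z.1 z.2 ^ p ∂π) ^ (1 / p) < c := by
  obtain ⟨Ω, _, P, f, g, _, hf, hg, rfl, rfl, hlt⟩ :=
    exists_randomVariables_of_wassersteinDist_lt hp h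
  refine ⟨P.map fun ω => (f ω, g ω), Measure.isProbabilityMeasure_map (hf.prodMk hg).aemeasurable,
    Measure.fst_map_prodMk hg, Measure.snd_map_prodMk hf, lt_of_le_of_lt ?_ hlt⟩
  exact ENNReal.rpow_le_rpow (lintegral_map_le _ _) (by positivity)

theorem aestronglyMeasurable_fst_of_innerRegular {Y : Type*} [MeasurableSpace Y]
    {π : Measure (X × Y)} [IsFiniteMeasure π] (h : π.fst.InnerRegular) :
    AEStronglyMeasurable Prod.fst π :=
  aestronglyMeasurable_of_innerRegular_map measurable_fst.aemeasurable h

theorem aestronglyMeasurable_snd_of_innerRegular {Y : Type*} [MeasurableSpace Y]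
    {π : Measure (Y × X)} [IsFiniteMeasure π] (h : π.snd.InnerRegular) :
    AEStronglyMeasurable Prod.snd π :=
  aestronglyMeasurable_of_innerRegular_map measurable_snd.aemeasurable h

theorem wassersteinDist_fst_snd_le (hp : 0 ≤ p) (π : Measure (X × X)) [IsProbabilityMeasure π]
    (hfst : π.fst.InnerRegular) (hsnd : π.snd.InnerRegular) :
    wassersteinDist p π.fst π.snd ≤ (∫⁻ z, edist z.1 z.2 ^ p ∂π) ^ (1 / p) :=
  wassersteinDist_map_le hp (aestronglyMeasurable_fst_of_innerRegular hfst)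
    (aestronglyMeasurable_snd_of_innerRegular hsnd)

theorem aemeasurable_edist_of_innerRegular {π : Measure (X × X)} [IsFiniteMeasure π]
    (hfst : π.fst.InnerRegular) (hsnd : π.snd.InnerRegular) :
    AEMeasurable (fun z => edist z.1 z.2) π :=
  (aestronglyMeasurable_fst_of_innerRegular hfst).edist
    (aestronglyMeasurable_snd_of_innerRegular hsnd)

theorem wassersteinDist_snd_snd_le (hp : 1 ≤ p) {π ρ : Measure (X × X)} [IsProbabilityMeasure π]
    [IsProbabilityMeasure ρ] (h : π.fst = ρ.fst) (hfst : π.fst.InnerRegular)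
    (hπ : π.snd.InnerRegular) (hρ : ρ.snd.InnerRegular) :
    wassersteinDist p π.snd ρ.snd ≤ (∫⁻ z, edist z.1 z.2 ^ p ∂π) ^ (1 / p) +
      (∫⁻ z, edist z.1 z.2 ^ p ∂ρ) ^ (1 / p) := by
  have hedistπ := aemeasurable_edist_of_innerRegular hfst hπ
  have hedistρ := aemeasurable_edist_of_innerRegular (h ▸ hfst) hρ
  obtain ⟨θ, _, rfl, rfl⟩ := exists_gluing π ρ h hπ hρ
  have hid₁ : Measurable (Prod.map id Prod.fst : X × X × X → X × X) := by fun_prop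
  have hid₂ : Measurable (Prod.map id Prod.snd : X × X × X → X × X) := by fun_prop
  have hsnd₁ : (θ.map (Prod.map id Prod.fst)).snd = θ.map fun z => z.2.1 :=
    Measure.map_map measurable_snd hid₁
  have hsnd₂ : (θ.map (Prod.map id Prod.snd)).snd = θ.map fun z => z.2.2 :=
    Measure.map_map measurable_snd hid₂
  rw [lintegral_map' (hedistπ.pow_const p) hid₁.aemeasurable,
    lintegral_map' (hedistρ.pow_const p) hid₂.aemeasurable, hsnd₁, hsnd₂]
  calc wassersteinDist p (θ.map fun z => z.2.1) (θ.map fun z => z.2.2)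
      ≤ (∫⁻ z, edist z.2.1 z.2.2 ^ p ∂θ) ^ (1 / p) :=
        wassersteinDist_map_le (by positivity)
          (aestronglyMeasurable_of_innerRegular_map (by fun_prop) (hsnd₁ ▸ hπ))
          (aestronglyMeasurable_of_innerRegular_map (by fun_prop) (hsnd₂ ▸ hρ))
    _ ≤ (∫⁻ z, (edist z.1 z.2.1 + edist z.1 z.2.2) ^ p ∂θ) ^ (1 / p) := by
        gcongr with z
        exact edist_triangle_left _ _ _
    _ ≤ _ := ENNReal.lintegral_Lp_add_le (hedistπ.comp_measurable hid₁)
        (hedistρ.comp_measurable hid₂) hp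

theorem le_add_of_forall_gt {a b c : ℝ≥0∞} (h : ∀ a' > a, ∀ b' > b, c ≤ a' + b') : c ≤ a + b :=
  tsub_le_iff_right.1 <| le_of_forall_gt_imp_ge_of_dense fun a' ha => tsub_le_iff_tsub_le.1 <|
    le_of_forall_gt_imp_ge_of_dense fun b' hb => tsub_le_iff_left.2 (h a' ha b' hb)

theorem wassersteinDist_triangle (hp : 1 ≤ p) {μ ν ξ : Measure X} (hμ : μ.InnerRegular)
    (hν : ν.InnerRegular) (hξ : ξ.InnerRegular) :
    wassersteinDist p μ ξ ≤ wassersteinDist p μ ν + wassersteinDist p ν ξ := by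
  have hp₀ : 0 < p := by positivity
  rw [wassersteinDist_comm hp₀ μ ν]
  refine le_add_of_forall_gt fun a ha b hb => ?_
  obtain ⟨π, _, rfl, rfl, hπ⟩ := exists_measure_prod_of_wassersteinDist_lt hp₀ ha
  obtain ⟨ρ, _, hρν, rfl, hρ⟩ := exists_measure_prod_of_wassersteinDist_lt hp₀ hb
  exact (wassersteinDist_snd_snd_le hp hρν.symm hν hμ hξ).trans (add_le_add hπ.le hρ.le)

end Triangle

section Moment

variable {X : Type*} [MetricSpace X] {p : ℝ}

theorem edist_rpow_le (hp : 1 ≤ p) (x₀ x y : X) :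
    edist x y ^ p ≤ 2 ^ (p - 1) * (edist x₀ x ^ p + edist x₀ y ^ p) :=
  (ENNReal.rpow_le_rpow (edist_triangle_left _ _ _) (by positivity)).trans
    (ENNReal.rpow_add_le_mul_rpow_add_rpow _ _ hp)

variable [MeasurableSpace X]

theorem moment_ne_top_of_moment_ne_top (hp : 1 ≤ p) {x₀ : X} (x₁ : X) {μ : Measure X}
    [IsFiniteMeasure μ] (h : moment p x₀ μ ≠ ∞) : moment p x₁ μ ≠ ∞ := by
  have hle : moment p x₁ μ ≤ 2 ^ (p - 1) * (edist x₀ x₁ ^ p * μ Set.univ + moment p x₀ μ) := by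
    rw [moment, moment, ← lintegral_const, ← lintegral_add_left measurable_const,
      ← lintegral_const_mul' _ _ (by finiteness)]
    exact lintegral_mono fun x => edist_rpow_le hp x₀ x₁ x
  refine ne_top_of_le_ne_top ?_ hle
  have hdist : edist x₀ x₁ ^ p ≠ ∞ :=
    ENNReal.rpow_ne_top_of_nonneg (by positivity) (edist_ne_top _ _)
  finiteness

variable [BorelSpace X]

theorem lintegral_edist_rpow_le_moment (hp : 1 ≤ p) (x₀ : X) (π : Measure (X × X)) :
    ∫⁻ z, edist z.1 z.2 ^ p ∂π ≤ 2 ^ (p - 1) * (moment p x₀ π.fst + moment p x₀ π.snd) := by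
  have hm := measurable_edist_rpow p x₀
  rw [moment, moment, Measure.fst, Measure.snd, lintegral_map hm measurable_fst,
    lintegral_map hm measurable_snd,
    ← lintegral_add_left (f := fun z : X × X => edist x₀ z.1 ^ p) (hm.comp measurable_fst),
    ← lintegral_const_mul' _ _ (by finiteness)]
  exact lintegral_mono fun z => edist_rpow_le hp x₀ z.1 z.2

theorem wassersteinDist_ne_top (hp : 1 ≤ p) {x₀ : X} {μ ν : Measure X} [IsProbabilityMeasure μ]
    [IsProbabilityMeasure ν] (hμ : μ.InnerRegular) (hν : ν.InnerRegular)
    (hμ_fin : moment p x₀ μ ≠ ∞) (hν_fin : moment p x₀ ν ≠ ∞) : wassersteinDist p μ ν ≠ ∞ := by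
  have hW := wassersteinDist_fst_snd_le (p := p) (by positivity) (μ.prod ν)
  have hcost := lintegral_edist_rpow_le_moment hp x₀ (μ.prod ν)
  rw [Measure.fst_prod, Measure.snd_prod] at hW hcost
  refine ne_top_of_le_ne_top (ENNReal.rpow_ne_top_of_nonneg (by positivity) ?_) (hW hμ hν)
  exact ne_top_of_le_ne_top (by finiteness) hcost

end Moment

section SubMeasure

theorem exists_measure_prod_of_measure_univ_eq {A B : Type*} [MeasurableSpace A]
    [MeasurableSpace B] (α : Measure A) (β : Measure B) [IsFiniteMeasure α] [IsFiniteMeasure β]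
    (h : α Set.univ = β Set.univ) : ∃ π : Measure (A × B), π.fst = α ∧ π.snd = β := by
  rcases eq_or_ne α 0 with rfl | hα
  · have : β = 0 := Measure.measure_univ_eq_zero.1 (by simpa using h.symm)
    exact ⟨0, by simp [this]⟩
  have hinv : (α Set.univ)⁻¹ * α Set.univ = 1 :=
    ENNReal.inv_mul_cancel (by simpa using hα) (measure_ne_top α _)
  refine ⟨(α Set.univ)⁻¹ • α.prod β, ?_, ?_⟩
  · rw [Measure.fst, Measure.map_smul, Measure.map_fst_prod, ← h, smul_smul, hinv, one_smul]
  · rw [Measure.snd, Measure.map_smul, Measure.map_snd_prod, smul_smul, hinv, one_smul]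

variable {X : Type*} [MeasurableSpace X] {ι : Type*} [Fintype ι] {φ : ι → X → ℝ≥0∞}

theorem exists_measure_sum_add_eq (μ : Measure X) (hφ : ∀ i, Measurable (φ i))
    (hsum : ∀ x, ∑ i, φ i x ≤ 1) {c : ι → ℝ≥0∞} (hc : ∀ i, c i ≤ ∫⁻ x, φ i x ∂μ)
    (hfin : ∀ i, ∫⁻ x, φ i x ∂μ ≠ ∞) :
    ∃ (α : ι → Measure X) (ρ : Measure X), Measure.sum α + ρ = μ ∧
      (∀ i, α i Set.univ = c i) ∧ ∀ i, ∀ᵐ x ∂α i, φ i x ≠ 0 := by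
  set q : ι → ℝ≥0∞ := fun i => c i / ∫⁻ x, φ i x ∂μ
  have hq : ∀ i, q i ≤ 1 := fun i => ENNReal.div_le_of_le_mul (by simpa using hc i)
  have hm : ∀ i, Measurable fun x => q i * φ i x := fun i => (hφ i).const_mul _
  have hle : ∀ x, ∑ i, q i * φ i x ≤ 1 := fun x =>
    (Finset.sum_le_sum fun i _ => mul_le_of_le_one_left zero_le (hq i)).trans (hsum x)
  refine ⟨fun i => μ.withDensity fun x => q i * φ i x,
    μ.withDensity fun x => 1 - ∑ i, q i * φ i x, ?_, fun i => ?_, fun i => ?_⟩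
  · rw [← withDensity_tsum hm, ← withDensity_add_right]
    · conv_rhs => rw [← withDensity_one (μ := μ)]
      congr 1
      funext x
      simp only [tsum_fintype, Pi.add_apply, Finset.sum_apply, Pi.one_apply]
      exact add_tsub_cancel_of_le (hle x)
    · exact measurable_const.sub (Finset.measurable_sum _ fun i _ => hm i)
  · rw [withDensity_apply _ .univ, Measure.restrict_univ, lintegral_const_mul _ (hφ i)]
    exact ENNReal.div_mul_cancel' (fun h0 => le_antisymm (h0 ▸ hc i) zero_le)
      fun htop => absurd htop (hfin i)
  · exact (ae_withDensity_iff (hm i)).2 (.of_forall fun x => right_ne_zero_of_mul)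

/-- The part of the unit mass that cannot be matched between `μ` and `ν` within the pieces of a
family of densities `φ`: within the piece `i` the mass `min (∫ φ i dμ) (∫ φ i dν)` is matched. -/
noncomputable def unmatchedMass (φ : ι → X → ℝ≥0∞) (μ ν : Measure X) : ℝ≥0∞ :=
  1 - ∑ i, min (∫⁻ x, φ i x ∂μ) (∫⁻ x, φ i x ∂ν)

end SubMeasure

section Tail

variable {X : Type*} [MeasurableSpace X] {μ ρ : Measure X} {f : X → ℝ≥0∞}

theorem lintegral_le_mul_add_lintegral_tsub (h : ρ ≤ μ) (f : X → ℝ≥0∞) (C : ℝ≥0∞) :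
    ∫⁻ x, f x ∂ρ ≤ C * ρ Set.univ + ∫⁻ x, (f x - C) ∂μ :=
  calc ∫⁻ x, f x ∂ρ ≤ ∫⁻ x, (C + (f x - C)) ∂ρ := lintegral_mono fun _ => le_add_tsub
    _ = C * ρ Set.univ + ∫⁻ x, (f x - C) ∂ρ := by
      rw [lintegral_add_left measurable_const, lintegral_const]
    _ ≤ C * ρ Set.univ + ∫⁻ x, (f x - C) ∂μ := by gcongr

theorem lintegral_tsub_const_eq [IsFiniteMeasure μ] (hf : Measurable f) (C : ℝ≥0) :
    ∫⁻ x, (f x - C) ∂μ = ∫⁻ x, f x ∂μ - ∫⁻ x, min (f x) C ∂μ := by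
  have hfin : ∫⁻ x, min (f x) C ∂μ ≠ ∞ :=
    ne_top_of_le_ne_top (b := ∫⁻ _, C ∂μ) (by rw [lintegral_const]; finiteness)
      (lintegral_mono fun x => min_le_right _ _)
  refine ENNReal.eq_sub_of_add_eq hfin ?_
  rw [← lintegral_add_left (f := fun x => f x - C) (hf.sub measurable_const)]
  exact lintegral_congr fun x => tsub_add_min

theorem tendsto_lintegral_tsub_natCast (hf : Measurable f) (h : ∫⁻ x, f x ∂μ ≠ ∞) :
    Tendsto (fun n : ℕ => ∫⁻ x, (f x - n) ∂μ) atTop (𝓝 0) := by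
  have hlim : ∀ᵐ x ∂μ, Tendsto (fun n : ℕ => f x - n) atTop (𝓝 0) := by
    filter_upwards [ae_lt_top hf h] with x hx
    simpa using ENNReal.Tendsto.sub (tendsto_const_nhds (x := f x))
      ENNReal.tendsto_nat_nhds_top (.inl hx.ne)
  simpa using tendsto_lintegral_of_dominated_convergence f (fun n => hf.sub measurable_const)
    (fun n => .of_forall fun x => tsub_le_self) h hlim

end Tail

section Matching

variable {X : Type*} [MeasurableSpace X] {ι : Type*} [Fintype ι] {φ : ι → X → ℝ≥0∞}

theorem lintegral_ne_top_of_sum_le_one (hsum : ∀ x, ∑ i, φ i x ≤ 1) (μ : Measure X)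
    [IsFiniteMeasure μ] (i : ι) : ∫⁻ x, φ i x ∂μ ≠ ∞ :=
  ne_top_of_le_ne_top (b := ∫⁻ _, 1 ∂μ) (by simp) <| lintegral_mono fun x =>
    (Finset.single_le_sum_of_canonicallyOrdered (Finset.mem_univ i)).trans (hsum x)

theorem sum_measure_univ_add_eq {α : ι → Measure X} {ρ μ : Measure X} (h : Measure.sum α + ρ = μ) :
    ∑ i, α i Set.univ + ρ Set.univ = μ Set.univ := by
  rw [← h, Measure.add_apply, Measure.sum_apply _ .univ, tsum_fintype]

theorem exists_measure_prod_sum_add_eq (μ ν : Measure X) [IsProbabilityMeasure μ]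
    [IsProbabilityMeasure ν] (hφ : ∀ i, Measurable (φ i)) (hsum : ∀ x, ∑ i, φ i x ≤ 1) :
    ∃ (π : ι → Measure (X × X)) (π' : Measure (X × X)),
      (Measure.sum π + π').fst = μ ∧ (Measure.sum π + π').snd = ν ∧
      (∀ i, ∀ᵐ x ∂(π i).fst, φ i x ≠ 0) ∧ (∀ i, ∀ᵐ x ∂(π i).snd, φ i x ≠ 0) ∧
      π' Set.univ = unmatchedMass φ μ ν := by
  set c : ι → ℝ≥0∞ := fun i => min (∫⁻ x, φ i x ∂μ) (∫⁻ x, φ i x ∂ν)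
  obtain ⟨α, ρ, hα, hαc, hαφ⟩ := exists_measure_sum_add_eq μ hφ hsum (c := c)
    (fun i => min_le_left _ _) (lintegral_ne_top_of_sum_le_one hsum μ)
  obtain ⟨β, σ, hβ, hβc, hβφ⟩ := exists_measure_sum_add_eq ν hφ hsum (c := c)
    (fun i => min_le_right _ _) (lintegral_ne_top_of_sum_le_one hsum ν)
  have hc : ∀ i, c i ≠ ∞ := fun i =>
    ne_top_of_le_ne_top (lintegral_ne_top_of_sum_le_one hsum μ i) (min_le_left _ _)
  have hρ : ρ Set.univ = unmatchedMass φ μ ν := by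
    refine ENNReal.eq_sub_of_add_eq (ENNReal.sum_ne_top.2 fun i _ => hc i) ?_
    simpa [hαc, add_comm] using sum_measure_univ_add_eq hα
  have hσ : σ Set.univ = unmatchedMass φ μ ν := by
    refine ENNReal.eq_sub_of_add_eq (ENNReal.sum_ne_top.2 fun i _ => hc i) ?_
    simpa [hβc, add_comm] using sum_measure_univ_add_eq hβ
  have (i : ι) : IsFiniteMeasure (α i) := ⟨by rw [hαc]; exact (hc i).lt_top⟩
  have (i : ι) : IsFiniteMeasure (β i) := ⟨by rw [hβc]; exact (hc i).lt_top⟩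
  have : IsFiniteMeasure ρ := isFiniteMeasure_of_le μ (hα ▸ Measure.le_add_left le_rfl)
  have : IsFiniteMeasure σ := isFiniteMeasure_of_le ν (hβ ▸ Measure.le_add_left le_rfl)
  choose π hπα hπβ using fun i =>
    exists_measure_prod_of_measure_univ_eq (α i) (β i) ((hαc i).trans (hβc i).symm)
  obtain ⟨π', hπρ, hπσ⟩ := exists_measure_prod_of_measure_univ_eq ρ σ (hρ.trans hσ.symm)
  refine ⟨π, π', ?_, ?_, fun i => hπα i ▸ hαφ i, fun i => hπβ i ▸ hβφ i, ?_⟩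
  · rw [Measure.fst_add, Measure.fst_sum, funext hπα, hπρ, hα]
  · rw [Measure.snd_add, Measure.snd_sum, funext hπβ, hπσ, hβ]
  · rw [← Measure.fst_univ, hπρ, hρ]

end Matching

section Estimate

variable {X : Type*} [MetricSpace X] [MeasurableSpace X] {p : ℝ}

theorem lintegral_edist_rpow_le_of_ae (hp : 0 ≤ p) {π : Measure (X × X)} {y : X} {ε : ℝ≥0∞}
    (hfst : ∀ᵐ x ∂π.fst, edist y x ≤ ε) (hsnd : ∀ᵐ x ∂π.snd, edist y x ≤ ε) :
    ∫⁻ z, edist z.1 z.2 ^ p ∂π ≤ (2 * ε) ^ p * π Set.univ := by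
  rw [← lintegral_const]
  refine lintegral_mono_ae ?_
  filter_upwards [ae_of_ae_map measurable_fst.aemeasurable hfst,
    ae_of_ae_map measurable_snd.aemeasurable hsnd] with z hz₁ hz₂
  gcongr
  calc edist z.1 z.2 ≤ edist y z.1 + edist y z.2 := edist_triangle_left _ _ _
    _ ≤ 2 * ε := by rw [two_mul]; gcongr

/-- The mass of `d(x₀, -) ^ p` above the level `C`, by which the cost of moving a small part of
`μ` is bounded. -/
noncomputable def tailMoment (p : ℝ) (x₀ : X) (C : ℝ≥0∞) (μ : Measure X) : ℝ≥0∞ :=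
  ∫⁻ x, (edist x₀ x ^ p - C) ∂μ

variable [BorelSpace X] {ι : Type*} [Fintype ι] {φ : ι → X → ℝ≥0∞}

theorem wassersteinDist_rpow_le (hp : 1 ≤ p) (x₀ : X) (C : ℝ≥0∞) {μ ν : Measure X}
    [IsProbabilityMeasure μ] [IsProbabilityMeasure ν] (hμ : μ.InnerRegular) (hν : ν.InnerRegular)
    (hφ : ∀ i, Measurable (φ i)) (hsum : ∀ x, ∑ i, φ i x ≤ 1) {y : ι → X} {ε : ℝ≥0∞}
    (hsupp : ∀ i x, φ i x ≠ 0 → edist (y i) x ≤ ε) :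
    wassersteinDist p μ ν ^ p ≤ (2 * ε) ^ p + 2 ^ (p - 1) *
      (2 * C * unmatchedMass φ μ ν + (tailMoment p x₀ C μ + tailMoment p x₀ C ν)) := by
  obtain ⟨π, π', hfst, hsnd, hπ₁, hπ₂, hπ'⟩ := exists_measure_prod_sum_add_eq μ ν hφ hsum
  have : IsProbabilityMeasure (Measure.sum π + π') :=
    ⟨by rw [← Measure.fst_univ, hfst, measure_univ]⟩
  have hW := wassersteinDist_fst_snd_le (p := p) (by positivity) (Measure.sum π + π')
    (by rwa [hfst]) (by rwa [hsnd])
  rw [hfst, hsnd, one_div, ENNReal.le_rpow_inv_iff (by positivity), lintegral_add_measure,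
    lintegral_sum_measure, tsum_fintype] at hW
  have hmatched : ∑ i, ∫⁻ z, edist z.1 z.2 ^ p ∂π i ≤ (2 * ε) ^ p := by
    have hle : Measure.sum π Set.univ ≤ 1 :=
      (Measure.le_add_right le_rfl _).trans_eq (measure_univ (μ := Measure.sum π + π'))
    calc ∑ i, ∫⁻ z, edist z.1 z.2 ^ p ∂π i ≤ ∑ i, (2 * ε) ^ p * π i Set.univ :=
          Finset.sum_le_sum fun i _ => lintegral_edist_rpow_le_of_ae (by positivity)
            ((hπ₁ i).mono (hsupp i)) ((hπ₂ i).mono (hsupp i))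
      _ = (2 * ε) ^ p * Measure.sum π Set.univ := by
          rw [← Finset.mul_sum, Measure.sum_apply _ .univ, tsum_fintype]
      _ ≤ (2 * ε) ^ p := mul_le_of_le_one_right' hle
  have hunmatched : ∫⁻ z, edist z.1 z.2 ^ p ∂π' ≤ 2 ^ (p - 1) *
      (2 * C * unmatchedMass φ μ ν + (tailMoment p x₀ C μ + tailMoment p x₀ C ν)) := by
    have hfst' : π'.fst ≤ μ := by
      rw [← hfst, Measure.fst_add]; exact Measure.le_add_left le_rfl
    have hsnd' : π'.snd ≤ ν := by
      rw [← hsnd, Measure.snd_add]; exact Measure.le_add_left le_rfl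
    have hμ' := lintegral_le_mul_add_lintegral_tsub hfst' (fun x => edist x₀ x ^ p) C
    have hν' := lintegral_le_mul_add_lintegral_tsub hsnd' (fun x => edist x₀ x ^ p) C
    rw [Measure.fst_univ, hπ'] at hμ'
    rw [Measure.snd_univ, hπ'] at hν'
    calc ∫⁻ z, edist z.1 z.2 ^ p ∂π'
        ≤ 2 ^ (p - 1) * (moment p x₀ π'.fst + moment p x₀ π'.snd) :=
          lintegral_edist_rpow_le_moment hp x₀ π'
      _ ≤ 2 ^ (p - 1) * ((C * unmatchedMass φ μ ν + tailMoment p x₀ C μ) +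
            (C * unmatchedMass φ μ ν + tailMoment p x₀ C ν)) := by gcongr <;> assumption
      _ = _ := by ring
  exact hW.trans (add_le_add hmatched hunmatched)

end Estimate

section WassersteinToWeak

variable {X : Type*} [MetricSpace X] [MeasurableSpace X] [BorelSpace X] {p : ℝ}

theorem levyProkhorovEDist_le_of_wassersteinDist_lt (hp : 0 < p) {μ ν : Measure X}
    [IsProbabilityMeasure μ] [IsProbabilityMeasure ν] {δ : ℝ≥0∞} (hδ₀ : δ ≠ 0) (hδ : δ ≠ ∞)
    (h : wassersteinDist p μ ν < (δ ^ p * δ) ^ (1 / p)) : levyProkhorovEDist μ ν ≤ δ := by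
  obtain ⟨γ, hγ, hcost⟩ := exists_isCoupling_cost_lt hp h
  rw [ENNReal.rpow_lt_rpow_iff (by positivity)] at hcost
  refine levyProkhorovEDist_le_of_forall_le μ ν δ fun ε B hδε hε hB => ?_
  calc μ B ≤ ν (Metric.thickening δ.toReal B) + δ :=
        measure_le_thickening_add hp hγ hδ₀ hδ hcost.le hB
    _ ≤ ν (Metric.thickening ε.toReal B) + ε := by
        have hmono := Metric.thickening_mono (ENNReal.toReal_mono hε.ne hδε.le) B
        exact add_le_add (measure_mono hmono) hδε.le

theorem tendsto_of_tendsto_wassersteinDist (hp : 0 < p) {ι : Type*} {l : Filter ι}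
    {μs : ι → ProbabilityMeasure X} {μ : ProbabilityMeasure X}
    (h : Tendsto (fun i => wassersteinDist p (μs i : Measure X) (μ : Measure X)) l (𝓝 0)) :
    Tendsto μs l (𝓝 μ) := by
  suffices Tendsto (fun i => LevyProkhorov.ofMeasure (μs i)) l (𝓝 (LevyProkhorov.ofMeasure μ)) from
    (LevyProkhorov.continuous_toMeasure_probabilityMeasure.tendsto _).comp this
  rw [EMetric.tendsto_nhds]
  intro ε hε
  obtain ⟨δ, hδ₀, hδ⟩ := exists_between (lt_min hε one_pos)
  have hδ_top : δ ≠ ∞ := (hδ.trans_le (min_le_right _ _)).ne_top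
  have hpos : 0 < (δ ^ p * δ) ^ (1 / p) := by
    refine ENNReal.rpow_pos (ENNReal.mul_pos ?_ hδ₀.ne') (by finiteness)
    exact (ENNReal.rpow_pos hδ₀ hδ_top).ne'
  filter_upwards [h.eventually_lt_const hpos] with i hi
  rw [LevyProkhorov.edist_probabilityMeasure_def]
  exact (levyProkhorovEDist_le_of_wassersteinDist_lt hp hδ₀.ne' hδ_top hi).trans_lt
    (hδ.trans_le (min_le_left _ _))

theorem tendsto_moment_of_tendsto_wassersteinDist (hp : 1 ≤ p) (x₀ : X) {ι : Type*}
    {l : Filter ι} {μs : ι → Measure X} {μ : Measure X}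
    (h : Tendsto (fun i => wassersteinDist p (μs i) μ) l (𝓝 0)) :
    Tendsto (fun i => moment p x₀ (μs i)) l (𝓝 (moment p x₀ μ)) := by
  have hp₀ : 0 < p := by positivity
  have hroot : Tendsto (fun i => moment p x₀ (μs i) ^ (1 / p)) l (𝓝 (moment p x₀ μ ^ (1 / p))) := by
    refine tendsto_of_tendsto_of_tendsto_of_le_of_le
      (g := fun i => moment p x₀ μ ^ (1 / p) - wassersteinDist p (μs i) μ)
      (h := fun i => moment p x₀ μ ^ (1 / p) + wassersteinDist p (μs i) μ) ?_ ?_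
      (fun i => tsub_le_iff_right.2 ?_) fun i => moment_rpow_le hp x₀ _ _
    · simpa using ENNReal.Tendsto.sub (tendsto_const_nhds (x := moment p x₀ μ ^ (1 / p))) h
        (.inr ENNReal.zero_ne_top)
    · simpa using h.const_add (moment p x₀ μ ^ (1 / p))
    · rw [wassersteinDist_comm hp₀]
      exact moment_rpow_le hp x₀ _ _
  simpa [← ENNReal.rpow_mul, hp₀.ne'] using hroot.ennrpow_const p

theorem eq_of_wassersteinDist_eq_zero (hp : 0 < p) {μ ν : ProbabilityMeasure X}
    (h : wassersteinDist p (μ : Measure X) (ν : Measure X) = 0) : μ = ν :=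
  tendsto_nhds_unique (tendsto_const_nhds (f := (atTop : Filter ℕ)))
    (tendsto_of_tendsto_wassersteinDist hp (by simp [h]))

end WassersteinToWeak

section PartitionOfUnity

variable {X : Type*} [MetricSpace X]

theorem exists_finite_partition_of_isCompact {K : Set X} (hK : IsCompact K) {r : ℝ≥0}
    (hr : 0 < r) :
    ∃ (s : Finset X) (φ : s → X → ℝ≥0), (∀ i, Continuous (φ i)) ∧ (∀ x, ∑ i, φ i x ≤ 1) ∧
      (∀ i x, φ i x ≠ 0 → edist (i : X) x ≤ r) ∧ ∀ x ∈ K, ∑ i, φ i x = 1 := by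
  obtain ⟨s, -, hs⟩ := hK.elim_nhds_subcover (fun x => Metric.ball x r)
    (fun x _ => Metric.ball_mem_nhds x hr)
  obtain ⟨f, hf⟩ := PartitionOfUnity.exists_isSubordinate hK.isClosed
    (fun i : s => Metric.ball (i : X) r) (fun i => Metric.isOpen_ball)
    (by simpa [Set.iUnion_subtype] using hs)
  have hsum (x : X) : ((∑ i, (f i x).toNNReal : ℝ≥0) : ℝ) = ∑ᶠ i, f i x := by
    rw [finsum_eq_sum_of_fintype, NNReal.coe_sum]
    exact Finset.sum_congr rfl fun i _ => Real.coe_toNNReal _ (f.nonneg i x)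
  refine ⟨s, fun i x => (f i x).toNNReal, fun i => by fun_prop, fun x => ?_, fun i x hx => ?_,
    fun x hx => ?_⟩
  · rw [← NNReal.coe_le_coe, hsum]
    exact f.sum_le_one x
  · have hmem : x ∈ Metric.ball (i : X) r :=
      hf i (subset_tsupport _ fun h0 : f i x = 0 => hx (by simp [h0]))
    rw [← Metric.eball_coe, Metric.mem_eball'] at hmem
    exact hmem.le
  · rw [← NNReal.coe_inj, hsum, f.sum_eq_one hx, NNReal.coe_one]

theorem exists_finite_partition_of_innerRegular [MeasurableSpace X] [BorelSpace X] (μ : Measure X)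
    [IsProbabilityMeasure μ] (h : μ.InnerRegular) {r : ℝ≥0} (hr : 0 < r) :
    ∃ (s : Finset X) (φ : s → X → ℝ≥0), (∀ i, Continuous (φ i)) ∧ (∀ x, ∑ i, φ i x ≤ 1) ∧
      (∀ i x, φ i x ≠ 0 → edist (i : X) x ≤ r) ∧ 1 - ∑ i, ∫⁻ x, φ i x ∂μ ≤ r := by
  have hlt : 1 - (r : ℝ≥0∞) < μ Set.univ := by
    rw [measure_univ]
    exact ENNReal.sub_lt_self ENNReal.one_ne_top one_ne_zero (by simpa using hr.ne')
  obtain ⟨K, -, hK, hKμ⟩ := MeasurableSet.univ.exists_lt_isCompact hlt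
  obtain ⟨s, φ, hφ, hφ_le, hφ_supp, hφK⟩ := exists_finite_partition_of_isCompact hK hr
  refine ⟨s, φ, hφ, hφ_le, hφ_supp, tsub_le_iff_tsub_le.1 (hKμ.le.trans ?_)⟩
  rw [← lintegral_finsetSum _ fun i _ => (hφ i).measurable.coe_nnreal_ennreal,
    ← lintegral_indicator_one hK.measurableSet]
  refine lintegral_mono fun x => Set.indicator_apply_le' (fun hx => ?_) fun _ => zero_le
  rw [← ENNReal.ofNNReal_finsetSum, hφK x hx]
  rfl

end PartitionOfUnity

section WeakToWasserstein

variable {X : Type*} [MetricSpace X] [MeasurableSpace X] [BorelSpace X]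
  {ι : Type*} {l : Filter ι} {μs : ι → ProbabilityMeasure X} {μ : ProbabilityMeasure X}

theorem tendsto_lintegral_of_continuous_of_le (h : Tendsto μs l (𝓝 μ)) {f : X → ℝ≥0}
    (hf : Continuous f) {C : ℝ≥0} (hC : ∀ x, f x ≤ C) :
    Tendsto (fun i => ∫⁻ x, f x ∂(μs i : Measure X)) l (𝓝 (∫⁻ x, f x ∂(μ : Measure X))) := by
  refine ProbabilityMeasure.tendsto_iff_forall_lintegral_tendsto.1 h
    (BoundedContinuousFunction.mkOfBound ⟨f, hf⟩ C fun x y => ?_)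
  rw [ContinuousMap.coe_mk, NNReal.dist_eq]
  exact abs_sub_le_of_nonneg_of_le (f x).2 (hC x) (f y).2 (hC y)

theorem tendsto_lintegral_tsub_const (h : Tendsto μs l (𝓝 μ)) {f : X → ℝ≥0} (hf : Continuous f)
    (hlim : Tendsto (fun i => ∫⁻ x, f x ∂(μs i : Measure X)) l
      (𝓝 (∫⁻ x, f x ∂(μ : Measure X))))
    (hfin : ∫⁻ x, f x ∂(μ : Measure X) ≠ ∞) (C : ℝ≥0) :
    Tendsto (fun i => ∫⁻ x, (f x - C) ∂(μs i : Measure X)) l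
      (𝓝 (∫⁻ x, (f x - C) ∂(μ : Measure X))) := by
  simp only [lintegral_tsub_const_eq hf.measurable.coe_nnreal_ennreal]
  refine ENNReal.Tendsto.sub hlim ?_ (.inl hfin)
  exact_mod_cast tendsto_lintegral_of_continuous_of_le h (hf.min continuous_const)
    fun x => min_le_right (f x) C

theorem tendsto_tailMoment {p : ℝ} (hp : 0 ≤ p) {x₀ : X} (h : Tendsto μs l (𝓝 μ))
    (hmom : Tendsto (fun i => moment p x₀ (μs i : Measure X)) l (𝓝 (moment p x₀ (μ : Measure X))))
    (hfin : moment p x₀ (μ : Measure X) ≠ ∞) (C : ℝ≥0) :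
    Tendsto (fun i => tailMoment p x₀ C (μs i : Measure X)) l
      (𝓝 (tailMoment p x₀ C (μ : Measure X))) := by
  have hcoe (x : X) : edist x₀ x ^ p = ((nndist x₀ x ^ p : ℝ≥0) : ℝ≥0∞) := by
    rw [edist_nndist, ENNReal.coe_rpow_of_nonneg _ hp]
  simp only [moment, tailMoment, hcoe] at hmom hfin ⊢
  exact tendsto_lintegral_tsub_const h
    ((NNReal.continuous_rpow_const hp).comp (by fun_prop)) hmom hfin C

theorem tendsto_unmatchedMass (h : Tendsto μs l (𝓝 μ)) {κ : Type*} [Fintype κ]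
    {φ : κ → X → ℝ≥0} (hφ : ∀ i, Continuous (φ i)) (hsum : ∀ x, ∑ i, φ i x ≤ 1) :
    Tendsto (fun i => unmatchedMass (fun k x => (φ k x : ℝ≥0∞)) (μs i : Measure X) μ) l
      (𝓝 (1 - ∑ k, ∫⁻ x, φ k x ∂(μ : Measure X))) := by
  have hle (k : κ) (x : X) : φ k x ≤ 1 :=
    (Finset.single_le_sum_of_canonicallyOrdered (f := fun k => φ k x) (Finset.mem_univ k)).trans
      (hsum x)
  refine ENNReal.Tendsto.sub tendsto_const_nhds (tendsto_finsetSum _ fun k _ => ?_)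
    (.inl ENNReal.one_ne_top)
  simpa using (tendsto_lintegral_of_continuous_of_le h (hφ k) (hle k)).min
    (tendsto_const_nhds (x := ∫⁻ x, φ k x ∂(μ : Measure X)))

theorem eventually_wassersteinDist_rpow_lt {p : ℝ} (hp : 1 ≤ p) {x₀ : X}
    (hμs : ∀ i, (μs i : Measure X).InnerRegular) (hμ : (μ : Measure X).InnerRegular)
    (h : Tendsto μs l (𝓝 μ))
    (hmom : Tendsto (fun i => moment p x₀ (μs i : Measure X)) l (𝓝 (moment p x₀ (μ : Measure X))))
    (hfin : moment p x₀ (μ : Measure X) ≠ ∞) {C r : ℝ≥0} (hr : 0 < r) {δ : ℝ≥0∞}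
    (hδ : (2 * r) ^ p + 2 ^ (p - 1) *
      (2 * C * r + (tailMoment p x₀ C μ + tailMoment p x₀ C (μ : Measure X))) < δ) :
    ∀ᶠ i in l, wassersteinDist p (μs i : Measure X) (μ : Measure X) ^ p < δ := by
  obtain ⟨s, φ, hφ, hsum, hsupp, hmass⟩ :=
    exists_finite_partition_of_innerRegular (μ : Measure X) hμ hr
  have hlim : Tendsto (fun i => (2 * (r : ℝ≥0∞)) ^ p + 2 ^ (p - 1) *
      (2 * C * unmatchedMass (fun k x => (φ k x : ℝ≥0∞)) (μs i : Measure X) μ +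
        (tailMoment p x₀ C (μs i : Measure X) + tailMoment p x₀ C (μ : Measure X)))) l
      (𝓝 ((2 * r) ^ p + 2 ^ (p - 1) * (2 * C * (1 - ∑ k, ∫⁻ x, φ k x ∂(μ : Measure X)) +
        (tailMoment p x₀ C μ + tailMoment p x₀ C (μ : Measure X))))) :=
    (ENNReal.Tendsto.const_mul ((ENNReal.Tendsto.const_mul (tendsto_unmatchedMass h hφ hsum)
      (.inr (by finiteness))).add ((tendsto_tailMoment (by positivity) h hmom hfin C).add_const _))
      (.inr (by finiteness))).const_add _
  filter_upwards [hlim.eventually_lt_const (lt_of_le_of_lt (by gcongr) hδ)] with i hi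
  exact (wassersteinDist_rpow_le hp x₀ C (hμs i) hμ
    (fun k => (hφ k).measurable.coe_nnreal_ennreal) (fun x => by exact_mod_cast hsum x)
    (fun k x hx => hsupp k x (by simpa using hx))).trans_lt hi

theorem exists_level_radius_error_lt {p : ℝ} (hp : 0 < p) {τ : ℕ → ℝ≥0∞}
    (hτ : Tendsto τ atTop (𝓝 0)) {δ : ℝ≥0∞} (hδ : 0 < δ) : ∃ n : ℕ, ∃ r : ℝ≥0, 0 < r ∧
      (2 * r) ^ p + 2 ^ (p - 1) * (2 * n * r + (τ n + τ n)) < δ := by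
  have htail : Tendsto (fun n => (2 : ℝ≥0∞) ^ (p - 1) * (τ n + τ n)) atTop (𝓝 0) := by
    simpa using ENNReal.Tendsto.const_mul (hτ.add hτ) (.inr (by finiteness))
  obtain ⟨n, hn⟩ := (htail.eventually_lt_const hδ).exists
  have hcont : Continuous fun r : ℝ≥0 =>
      (2 * (r : ℝ≥0∞)) ^ p + 2 ^ (p - 1) * (2 * n * r + (τ n + τ n)) :=
    (ENNReal.continuous_rpow_const.comp
      ((ENNReal.continuous_const_mul (by finiteness)).comp ENNReal.continuous_coe)).add
      ((ENNReal.continuous_const_mul (by finiteness)).comp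
        (((ENNReal.continuous_const_mul (by finiteness)).comp ENNReal.continuous_coe).add_const _))
  have hsmall : ∀ᶠ r : ℝ≥0 in 𝓝[>] 0,
      (2 * (r : ℝ≥0∞)) ^ p + 2 ^ (p - 1) * (2 * n * r + (τ n + τ n)) < δ :=
    (hcont.continuousWithinAt.tendsto).eventually_lt_const (by simpa [hp] using hn)
  obtain ⟨r, hlt, hr⟩ := (hsmall.and self_mem_nhdsWithin).exists
  exact ⟨n, r, hr, hlt⟩

theorem tendsto_wassersteinDist {p : ℝ} (hp : 1 ≤ p) {x₀ : X}
    (hμs : ∀ i, (μs i : Measure X).InnerRegular) (hμ : (μ : Measure X).InnerRegular)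
    (h : Tendsto μs l (𝓝 μ))
    (hmom : Tendsto (fun i => moment p x₀ (μs i : Measure X)) l (𝓝 (moment p x₀ (μ : Measure X))))
    (hfin : moment p x₀ (μ : Measure X) ≠ ∞) :
    Tendsto (fun i => wassersteinDist p (μs i : Measure X) (μ : Measure X)) l (𝓝 0) := by
  have hp₀ : 0 < p := by positivity
  have htail : Tendsto (fun n : ℕ => tailMoment p x₀ n (μ : Measure X)) atTop (𝓝 0) :=
    tendsto_lintegral_tsub_natCast (measurable_edist_rpow p x₀) hfin
  refine ENNReal.tendsto_nhds_zero.2 fun ε hε => ?_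
  obtain ⟨n, r, hr, hlt⟩ := exists_level_radius_error_lt hp₀ htail
    (ENNReal.rpow_pos_of_nonneg hε hp₀.le)
  filter_upwards [eventually_wassersteinDist_rpow_lt hp hμs hμ h hmom hfin (C := n) hr
    (by exact_mod_cast hlt)] with i hi
  exact (ENNReal.rpow_le_rpow_iff hp₀).1 hi.le

end WeakToWasserstein

section Metric

variable {X : Type*} [MetricSpace X] [MeasurableSpace X] [BorelSpace X] {p : ℝ}

theorem PSpace.moment_ne_top (hp : 1 ≤ p) (x₀ : X) (μ : PSpace p X) :
    moment p x₀ (μ.toProb : Measure X) ≠ ∞ :=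
  let ⟨_, h⟩ := μ.finite_moment
  moment_ne_top_of_moment_ne_top hp x₀ h.ne

/-- The Wasserstein distance of order `p` as an extended metric on `P_p(X)`. It is not an
instance, since it depends on `1 ≤ p`. -/
@[reducible]
noncomputable def PSpace.emetricSpace (hp : 1 ≤ p) : EMetricSpace (PSpace p X) where
  edist μ ν := wassersteinDist p (μ.toProb : Measure X) (ν.toProb : Measure X)
  edist_self _ := wassersteinDist_self (by positivity) _
  edist_comm _ _ := wassersteinDist_comm (by positivity) _ _
  edist_triangle μ ν ξ := wassersteinDist_triangle hp μ.radon ν.radon ξ.radon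
  eq_of_edist_eq_zero h := PSpace.ext (eq_of_wassersteinDist_eq_zero (by positivity) h)

theorem PSpace.wassersteinDist_ne_top (hp : 1 ≤ p) (μ ν : PSpace p X) :
    wassersteinDist p (μ.toProb : Measure X) (ν.toProb : Measure X) ≠ ∞ :=
  let ⟨x₀, _⟩ := μ.finite_moment
  Wasserstein.wassersteinDist_ne_top hp μ.radon ν.radon (μ.moment_ne_top hp x₀)
    (ν.moment_ne_top hp x₀)

theorem tendsto_wassersteinDist_iff_pWeakTendsto (hp : 1 ≤ p) (x₀ : X) (μs : ℕ → PSpace p X)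
    (μ : PSpace p X) :
    Tendsto (fun i => wassersteinDist p ((μs i).toProb : Measure X) (μ.toProb : Measure X)) atTop
      (𝓝 0) ↔ PWeakTendsto x₀ μs μ :=
  ⟨fun h => ⟨tendsto_of_tendsto_wassersteinDist (by positivity) h,
      tendsto_moment_of_tendsto_wassersteinDist hp x₀ h⟩,
    fun h => tendsto_wassersteinDist hp (fun i => (μs i).radon) μ.radon h.1 h.2
      (μ.moment_ne_top hp x₀)⟩

end Metric

end Wasserstein

open Wasserstein in
theorem mainTheorem5_general {X : Type*} [MetricSpace X] [MeasurableSpace X] [BorelSpace X]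
    (p : ℝ) (hp : 1 ≤ p) :
    ∃ _ : MetricSpace (PSpace p X),
      (∀ μ ν : PSpace p X,
        edist μ ν = wassersteinDist p (μ.toProb : Measure X) (ν.toProb : Measure X)) ∧
      ∀ (x₀ : X) (μs : ℕ → PSpace p X) (μ : PSpace p X),
        Tendsto μs atTop (𝓝 μ) ↔ PWeakTendsto x₀ μs μ :=
  letI := PSpace.emetricSpace (X := X) hp
  ⟨EMetricSpace.toMetricSpace (PSpace.wassersteinDist_ne_top hp), fun _ _ => rfl,
    fun x₀ μs μ => tendsto_iff_edist_tendsto_0.trans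
      (tendsto_wassersteinDist_iff_pWeakTendsto hp x₀ μs μ)⟩

theorem mainTheorem5 {X : Type*} [MetricSpace X] [CompleteSpace X] [MeasurableSpace X]
    [BorelSpace X] (p : ℝ) (hp : 1 ≤ p) :
    ∃ _ : MetricSpace (Wasserstein.PSpace p X),
      (∀ μ ν : Wasserstein.PSpace p X, edist μ ν =
        Wasserstein.wassersteinDist p (μ.toProb : Measure X) (ν.toProb : Measure X)) ∧
      ∀ (x₀ : X) (μs : ℕ → Wasserstein.PSpace p X) (μ : Wasserstein.PSpace p X),
        Tendsto μs atTop (𝓝 μ) ↔ Wasserstein.PWeakTendsto x₀ μs μ :=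
  mainTheorem5_general p hp
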